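/- Let $\theta\in\{\pi/4,\,3\pi/4\}$ and let $\alpha,\beta\in\mathbb{C}$ satisfy $|\alpha|^2+|\beta|^2=1$. On the Hilbert space $\ell^2(\mathbb{Z})\otimes\mathbb{C}^2$, with orthonormal bases $\{|x\rangle : x\in\mathbb{Z}\}$ of $\ell^2(\mathbb{Z})$ and $\{|0\rangle,|1\rangle\}$ of $\mathbb{C}^2$, let $$\begin{aligned} U_1=\sum_{x\in\mathbb{Z}}\Bigl[&|x-1\rangle\langle x|\otimes\tfrac{\cos\theta}{2}\bigl(|0\rangle\langle 0|-|1\rangle\langle 0|+|0\rangle\langle 1|-|1\rangle\langle 1|\bigr)+|x\rangle\langle x|\otimes\sin\theta\,\bigl(|0\rangle\langle 1|+|1\rangle\langle 0|\bigr)\\ &+|x+1\rangle\langle x|\otimes\tfrac{\cos\theta}{2}\bigl(|0\rangle\langle 0|+|1\rangle\langle 0|-|0\rangle\langle 1|-|1\rangle\langle 1|\bigr)\Bigr],\\ U_2=\sum_{x\in\mathbb{Z}}\Bigl[&|x-1\rangle\langle x|\otimes\sin\theta\,|0\rangle\langle 1|+|x\rangle\langle x|\otimes\cos\theta\,\bigl(|0\rangle\langle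 0|-|1\rangle\langle 1|\bigr)+|x+1\rangle\langle x|\otimes\sin\theta\,|1\rangle\langle 0|\Bigr]. \end{aligned}$$ Let $\Psi_0=|0\rangle\otimes(\alpha|0\rangle+\beta|1\rangle)$ and $\Psi_{t+1}=U_2U_1\Psi_t$ for $t=0,1,2,\dots$, and let $X_t$ be the position of the quantum walker at time $t$, that is, the $\mathbb{Z}$-valued random variable with $$\mathbb{P}(X_t=x)=\langle\Psi_t|\,\bigl\{|x\rangle\langle x|\otimes(|0\rangle\langle 0|+|1\rangle\langle 1|)\bigr\}\,|\Psi_t\rangle\qquad(x\in\mathbb{Z});$$ these numbers do form a probability distribution on $\mathbb{Z}$. Put $$\chi(y)=\frac{2\sqrt2}{\pi(4-y^2)\sqrt{2-y^2}}\Bigl\{1-\bigl(|\alpha|^2-|\beta|^2+\alpha\overline{\beta}+\overline{\alpha}\beta\bigr)\frac{y}{2}\Bigr\}\quad\text{for } y\in(-\sqrt2,\sqrt2),\qquad \chi(y)=0\quad\text{otherwise.}$$ Then $\chi$ is a probability density on $\mathbb{R}$ that is strictly positive on the whole interval $(-\sqrt2,\sqrt2)$ (so the limit distribution has no gap), and $X_t/t$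 converges in distribution to the law with density $\chi$: for every real number $x$, $$\lim_{t\to\infty}\mathbb{P}\Bigl(\frac{X_t}{t}\le x\Bigr)=\int_{-\infty}^{x}\chi(y)\,dy .$$ -/

import Mathlib

open MeasureTheory Filter Topology
open scoped ComplexConjugate

noncomputable section

namespace QWalk

/-- The coin space `ℂ²` with orthonormal basis `|0⟩, |1⟩`. -/
abbrev Coin : Type := EuclideanSpace ℂ (Fin 2)

/-- The Hilbert space `ℓ²(ℤ) ⊗ ℂ²` of the walk, realised as the space `ℓ²(ℤ; ℂ²)`;
`Ψ x` is the coin component of `Ψ` at the position `x`, and `|x⟩ ⊗ v` is `lp.single 2 x v`. -/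
abbrev Space : Type := lp (fun _ : ℤ => Coin) 2

theorem memℓp_hop (d : ℤ) (A : Matrix (Fin 2) (Fin 2) ℂ) (Ψ : Space) :
    Memℓp (fun x : ℤ => (Matrix.toEuclideanCLM (n := Fin 2) (𝕜 := ℂ) A (Ψ (x - d)) : Coin)) 2 := by
  have h : Summable fun x : ℤ => ‖Ψ x‖ ^ (2 : ENNReal).toReal :=
    (lp.memℓp Ψ).summable (by norm_num)
  have h2 : Summable fun x : ℤ => ‖Ψ (x - d)‖ ^ (2 : ENNReal).toReal :=
    h.comp_injective (sub_left_injective (b := d))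
  refine memℓp_gen (Summable.of_nonneg_of_le (fun x => by positivity) (fun x => ?_)
    (h2.mul_left (‖Matrix.toEuclideanCLM (n := Fin 2) (𝕜 := ℂ) A‖ ^ (2 : ENNReal).toReal)))
  rw [← Real.mul_rpow (norm_nonneg _) (norm_nonneg _)]
  exact Real.rpow_le_rpow (norm_nonneg _) (ContinuousLinearMap.le_opNorm _ _) (by norm_num)

/-- The operator `∑ₓ |x + d⟩⟨x| ⊗ A`. -/
def hop (d : ℤ) (A : Matrix (Fin 2) (Fin 2) ℂ) : Space →ₗ[ℂ] Space where
  toFun Ψ := ⟨fun x => Matrix.toEuclideanCLM (n := Fin 2) (𝕜 := ℂ) A (Ψ (x - d)), memℓp_hop d A Ψ⟩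
  map_add' Ψ Φ := by
    ext1; funext x
    exact map_add (Matrix.toEuclideanCLM (n := Fin 2) (𝕜 := ℂ) A) (Ψ (x - d)) (Φ (x - d))
  map_smul' z Ψ := by
    ext1; funext x
    exact map_smul (Matrix.toEuclideanCLM (n := Fin 2) (𝕜 := ℂ) A) z (Ψ (x - d))

/-- The matrix `|i⟩⟨j|` on the coin space. -/
def ketbra (i j : Fin 2) : Matrix (Fin 2) (Fin 2) ℂ := Matrix.single i j 1

/-- The first unitary operation. -/
def U₁ (θ : ℝ) : Space →ₗ[ℂ] Space :=
  hop (-1) (((Real.cos θ / 2 : ℝ) : ℂ) • (ketbra 0 0 - ketbra 1 0 + ketbra 0 1 - ketbra 1 1))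
    + hop 0 ((Real.sin θ : ℂ) • (ketbra 0 1 + ketbra 1 0))
    + hop 1 (((Real.cos θ / 2 : ℝ) : ℂ) • (ketbra 0 0 + ketbra 1 0 - ketbra 0 1 - ketbra 1 1))

/-- The second unitary operation. -/
def U₂ (θ : ℝ) : Space →ₗ[ℂ] Space :=
  hop (-1) ((Real.sin θ : ℂ) • ketbra 0 1)
    + hop 0 ((Real.cos θ : ℂ) • (ketbra 0 0 - ketbra 1 1))
    + hop 1 ((Real.sin θ : ℂ) • ketbra 1 0)

/-- The state `Ψ_t`: it starts at `|0⟩ ⊗ (α|0⟩ + β|1⟩)` and satisfies `Ψ_{t+1} = U₂ U₁ Ψ_t`. -/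
def state (θ : ℝ) (α β : ℂ) : ℕ → Space
  | 0 => lp.single 2 (0 : ℤ) !₂[α, β]
  | t + 1 => U₂ θ (U₁ θ (state θ α β t))

/-- The projection `|x⟩⟨x| ⊗ (|0⟩⟨0| + |1⟩⟨1|)`, applied to `Ψ`. -/
def positionProj (x : ℤ) (Ψ : Space) : Space := lp.single 2 x (Ψ x)

/-- The finding probability `ℙ(X_t = x) = ⟨Ψ_t| {|x⟩⟨x| ⊗ (|0⟩⟨0| + |1⟩⟨1|)} |Ψ_t⟩`. -/
def findingProb (θ : ℝ) (α β : ℂ) (t : ℕ) (x : ℤ) : ℝ :=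
  (inner ℂ (state θ α β t) (positionProj x (state θ α β t))).re

/-- The law of the position `X_t` on `ℤ`. -/
def law (θ : ℝ) (α β : ℂ) (t : ℕ) : Measure ℤ :=
  Measure.sum fun x : ℤ => ENNReal.ofReal (findingProb θ α β t x) • Measure.dirac x

/-- The limit density (the number `α β̄ + ᾱ β` is real). -/
def limitDensity (α β : ℂ) : ℝ → ℝ :=
  (Set.Ioo (-√2) √2).indicator fun y =>
    2 * √2 / (Real.pi * (4 - y ^ 2) * √(2 - y ^ 2)) *
      (1 - (‖α‖ ^ 2 - ‖β‖ ^ 2 + (α * conj β + conj α * β).re) * (y / 2))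

end QWalk

end

/-! By Lévy continuity it suffices that the characteristic function of `X_t / t` converges pointwise
to that of the limit law. In momentum space a step is multiplication by a unitary 2×2 matrix `symbol
θ k`, and Parseval turns E exp(iξX_t/t) into the mean over `k` of ⟨φ, S(k)^{*t} S(k − ξ/t)^t φ⟩,
where S is the symbol and φ the initial coin state (`integral_exp_law`).

For θ = π/4, S(k) = cos ω + i sin ω · N(k), with ω = `phase` and N = `axis` a Hermitian involution
(`symbol_pi_div_four`). Since t(ω(k − ξ/t) − ω(k)) → −ξω'(k) and N is continuous, the overlap tends
to cos(ξv) − i sin(ξv)⟨φ, Nφ⟩, where v = ω' is `velocity`; dominated convergence passes to the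
integral. Dropping odd functions of `k` replaces the integrand by (1 − Mv/2)e^{iξv}, where M is
`bias`. As v maps (−π, π) increasingly onto (−√2, √2), substituting y = v(k) produces the density
(`deriv_mul_limitDensity_velocity`).

The absence of a gap reflects the band touching at k = 0: the two eigenvalues e^{±iω} meet there,
yet ω and N extend smoothly through that point, so all velocities near 0 occur. The case θ = 3π/4 is
the same walk up to a shift of `k` by π and a sign (`symbol_add_pi`). -/

noncomputable section

namespace QWalk

/-! ### Fourier transform of the walk -/

/-- The Fourier transform `k ↦ ∑ₓ e^{-ikx} Ψ(x)`, meaningful for finitely supported `Ψ`. -/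
def fourier (Ψ : Space) (k : ℝ) : Coin := ∑' x : ℤ, Complex.exp (-(k * x * Complex.I)) • Ψ x

/-- Finite support propagates along the walk, so every Fourier series that occurs is a finite sum
and no convergence question arises. -/
theorem finite_support_hop (d : ℤ) (A : Matrix (Fin 2) (Fin 2) ℂ) {Ψ : Space}
    (h : (Function.support (Ψ : ℤ → Coin)).Finite) :
    (Function.support (hop d A Ψ : ℤ → Coin)).Finite := by
  refine (h.preimage (f := fun x : ℤ => x - d) (sub_left_injective.injOn)).subset fun x hx => ?_
  simp only [Set.mem_preimage, Function.mem_support] at hx ⊢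
  intro h0
  apply hx
  change Matrix.toEuclideanCLM (n := Fin 2) (𝕜 := ℂ) A (Ψ (x - d)) = 0
  rw [h0, map_zero]

theorem finite_support_add {Ψ Φ : Space} (h : (Function.support (Ψ : ℤ → Coin)).Finite)
    (h' : (Function.support (Φ : ℤ → Coin)).Finite) :
    (Function.support ((Ψ + Φ : Space) : ℤ → Coin)).Finite := by
  rw [lp.coeFn_add]
  exact (h.union h').subset (Function.support_add _ _)

theorem summable_fourier {Ψ : Space} (h : (Function.support (Ψ : ℤ → Coin)).Finite) (k : ℝ) :
    Summable fun x : ℤ => Complex.exp (-(k * x * Complex.I)) • Ψ x :=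
  summable_of_hasFiniteSupport (h.subset fun _ hx h0 => hx (by simp [h0]))

theorem fourier_add {Ψ Φ : Space} (h : (Function.support (Ψ : ℤ → Coin)).Finite)
    (h' : (Function.support (Φ : ℤ → Coin)).Finite) (k : ℝ) :
    fourier (Ψ + Φ) k = fourier Ψ k + fourier Φ k := by
  unfold fourier
  rw [← (summable_fourier h k).tsum_add (summable_fourier h' k)]
  simp [smul_add]

theorem fourier_hop (d : ℤ) (A : Matrix (Fin 2) (Fin 2) ℂ) {Ψ : Space}
    (h : (Function.support (Ψ : ℤ → Coin)).Finite) (k : ℝ) :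
    fourier (hop d A Ψ) k = Matrix.toEuclideanCLM (n := Fin 2) (𝕜 := ℂ)
      (Complex.exp (-(k * d * Complex.I)) • A) (fourier Ψ k) := by
  unfold fourier
  rw [ContinuousLinearMap.map_tsum _ (summable_fourier h k), ← (Equiv.addRight d).tsum_eq]
  refine tsum_congr fun x => ?_
  have hx : (hop d A Ψ : ℤ → Coin) (x + d)
      = Matrix.toEuclideanCLM (n := Fin 2) (𝕜 := ℂ) A (Ψ x) := by
    change Matrix.toEuclideanCLM (n := Fin 2) (𝕜 := ℂ) A (Ψ (x + d - d)) = _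
    rw [add_sub_cancel_right]
  simp only [Equiv.coe_addRight, hx, map_smul, smul_apply, smul_smul,
    ← Complex.exp_add]
  congr 2
  push_cast
  ring

theorem fourier_single (v : Coin) (k : ℝ) : fourier (lp.single 2 (0 : ℤ) v) k = v := by
  unfold fourier
  rw [tsum_eq_single 0]
  · simp
  · intro x hx
    simp [hx]

/-- The symbol of `U₁` in the momentum representation. -/
def symbol₁ (θ k : ℝ) : Matrix (Fin 2) (Fin 2) ℂ :=
  !![(Real.cos θ : ℂ) * Real.cos k, Real.sin θ + Real.cos θ * Real.sin k * Complex.I;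
    Real.sin θ - Real.cos θ * Real.sin k * Complex.I, -(Real.cos θ * Real.cos k)]

/-- The symbol of `U₂` in the momentum representation. -/
def symbol₂ (θ k : ℝ) : Matrix (Fin 2) (Fin 2) ℂ :=
  !![(Real.cos θ : ℂ), Real.sin θ * (Real.cos k + Real.sin k * Complex.I);
    Real.sin θ * (Real.cos k - Real.sin k * Complex.I), -Real.cos θ]

/-- The symbol of one step `U₂ U₁` of the walk. -/
def symbol (θ k : ℝ) : Matrix (Fin 2) (Fin 2) ℂ := symbol₂ θ k * symbol₁ θ k

theorem exp_neg_mul_I (k : ℝ) :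
    Complex.exp (-(k * Complex.I)) = Real.cos k - Real.sin k * Complex.I := by
  rw [← neg_mul, Complex.exp_mul_I]
  push_cast
  rw [Complex.cos_neg, Complex.sin_neg]
  ring

theorem exp_mul_I (k : ℝ) :
    Complex.exp (k * Complex.I) = Real.cos k + Real.sin k * Complex.I := by
  rw [Complex.exp_mul_I]
  push_cast
  ring

theorem fourier_U₁ (θ : ℝ) {Ψ : Space} (h : (Function.support (Ψ : ℤ → Coin)).Finite) (k : ℝ) :
    fourier (U₁ θ Ψ) k = Matrix.toEuclideanCLM (n := Fin 2) (𝕜 := ℂ) (symbol₁ θ k)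
      (fourier Ψ k) := by
  simp only [U₁, LinearMap.add_apply]
  rw [fourier_add (finite_support_add (finite_support_hop _ _ h) (finite_support_hop _ _ h))
    (finite_support_hop _ _ h), fourier_add (finite_support_hop _ _ h) (finite_support_hop _ _ h),
    fourier_hop _ _ h, fourier_hop _ _ h, fourier_hop _ _ h, ← add_apply,
    ← add_apply, ← map_add, ← map_add]
  congr 2
  ext i j
  fin_cases i <;> fin_cases j <;>
    simp [ketbra, symbol₁, exp_mul_I, exp_neg_mul_I, -Complex.ofReal_cos, -Complex.ofReal_sin] <;>
    ring

theorem fourier_U₂ (θ : ℝ) {Ψ : Space} (h : (Function.support (Ψ : ℤ → Coin)).Finite) (k : ℝ) :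
    fourier (U₂ θ Ψ) k = Matrix.toEuclideanCLM (n := Fin 2) (𝕜 := ℂ) (symbol₂ θ k)
      (fourier Ψ k) := by
  simp only [U₂, LinearMap.add_apply]
  rw [fourier_add (finite_support_add (finite_support_hop _ _ h) (finite_support_hop _ _ h))
    (finite_support_hop _ _ h), fourier_add (finite_support_hop _ _ h) (finite_support_hop _ _ h),
    fourier_hop _ _ h, fourier_hop _ _ h, fourier_hop _ _ h, ← add_apply,
    ← add_apply, ← map_add, ← map_add]
  congr 2
  ext i j
  fin_cases i <;> fin_cases j <;>
    simp [ketbra, symbol₂, exp_mul_I, exp_neg_mul_I, -Complex.ofReal_cos, -Complex.ofReal_sin] <;>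
    ring

theorem finite_support_U₁ (θ : ℝ) {Ψ : Space} (h : (Function.support (Ψ : ℤ → Coin)).Finite) :
    (Function.support (U₁ θ Ψ : ℤ → Coin)).Finite :=
  finite_support_add (finite_support_add (finite_support_hop _ _ h) (finite_support_hop _ _ h))
    (finite_support_hop _ _ h)

theorem finite_support_U₂ (θ : ℝ) {Ψ : Space} (h : (Function.support (Ψ : ℤ → Coin)).Finite) :
    (Function.support (U₂ θ Ψ : ℤ → Coin)).Finite :=
  finite_support_add (finite_support_add (finite_support_hop _ _ h) (finite_support_hop _ _ h))
    (finite_support_hop _ _ h)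

theorem finite_support_state (θ : ℝ) (α β : ℂ) (t : ℕ) :
    (Function.support (state θ α β t : ℤ → Coin)).Finite := by
  induction t with
  | zero =>
    refine (Set.finite_singleton (0 : ℤ)).subset fun x hx => ?_
    by_contra h
    exact hx (lp.single_apply_ne (E := fun _ : ℤ => Coin) 2 (0 : ℤ) !₂[α, β] h)
  | succ t ih => exact finite_support_U₂ θ (finite_support_U₁ θ ih)

theorem fourier_state (θ : ℝ) (α β : ℂ) (t : ℕ) (k : ℝ) :
    fourier (state θ α β t) k =
      Matrix.toEuclideanCLM (n := Fin 2) (𝕜 := ℂ) (symbol θ k ^ t) !₂[α, β] := by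
  induction t with
  | zero =>
    rw [pow_zero, map_one]
    exact fourier_single _ k
  | succ t ih =>
    have h := finite_support_state θ α β t
    rw [state, fourier_U₂ θ (finite_support_U₁ θ h), fourier_U₁ θ h, ih, pow_succ', symbol,
      map_mul, map_mul]
    rfl

/-! ### Parseval identity -/

theorem integral_exp_int_mul_I (n : ℤ) :
    ∫ k in (-Real.pi)..Real.pi, Complex.exp (k * n * Complex.I) =
      if n = 0 then (2 * Real.pi : ℂ) else 0 := by
  split_ifs with h
  · subst h
    simp
    ring
  · have hn : (n * Complex.I : ℂ) ≠ 0 := mul_ne_zero (by exact_mod_cast h) Complex.I_ne_zero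
    have := integral_exp_mul_complex (a := -Real.pi) (b := Real.pi) hn
    simp only [mul_comm (n * Complex.I : ℂ), ← mul_assoc] at this
    rw [this, div_eq_zero_iff]
    left
    rw [sub_eq_zero, Complex.exp_eq_exp_iff_exists_int]
    -- The exponents at π and −π differ by 2πi·n.
    refine ⟨n, ?_⟩
    push_cast
    ring

/-- Expanding both transforms, orthogonality of characters keeps only the diagonal terms; the shift
by `η` leaves the phase e^{iηx} on each. This is how a characteristic function is read off in
momentum space. -/
theorem integral_inner_fourier {Ψ : Space} (h : (Function.support (Ψ : ℤ → Coin)).Finite) (η : ℝ) :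
    ∫ k in (-Real.pi)..Real.pi, inner ℂ (fourier Ψ k) (fourier Ψ (k - η)) =
      2 * Real.pi * ∑' x : ℤ, (‖Ψ x‖ ^ 2 : ℝ) • Complex.exp (η * x * Complex.I) := by
  have hF : ∀ k, fourier Ψ k = ∑ x ∈ h.toFinset, Complex.exp (-(k * x * Complex.I)) • Ψ x := by
    intro k
    refine tsum_eq_sum fun x hx => ?_
    have : Ψ x = 0 := by simpa using hx
    rw [this, smul_zero]
  have hT : ∑' x : ℤ, (‖Ψ x‖ ^ 2 : ℝ) • Complex.exp (η * x * Complex.I) =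
      ∑ x ∈ h.toFinset, (‖Ψ x‖ ^ 2 : ℝ) • Complex.exp (η * x * Complex.I) := by
    refine tsum_eq_sum fun x hx => ?_
    have : Ψ x = 0 := by simpa using hx
    simp [this]
  have hI : ∀ k : ℝ, inner ℂ (fourier Ψ k) (fourier Ψ (k - η)) =
      ∑ x ∈ h.toFinset, ∑ y ∈ h.toFinset, (Complex.exp (η * y * Complex.I) *
        inner ℂ (Ψ x) (Ψ y)) * Complex.exp (k * (x - y : ℤ) * Complex.I) := by
    intro k
    rw [hF, hF, sum_inner]
    refine Finset.sum_congr rfl fun x _ => ?_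
    rw [inner_sum]
    refine Finset.sum_congr rfl fun y _ => ?_
    rw [inner_smul_left, inner_smul_right, ← Complex.exp_conj]
    have e : Complex.exp (conj (-(k * x * Complex.I) : ℂ)) *
        Complex.exp (-(((k - η : ℝ) : ℂ) * y * Complex.I)) =
        Complex.exp (η * y * Complex.I) * Complex.exp (k * (x - y : ℤ) * Complex.I) := by
      rw [← Complex.exp_add, ← Complex.exp_add]
      congr 1
      simp
      ring
    rw [← mul_assoc, e]
    ring
  simp_rw [hI]
  rw [hT, intervalIntegral.integral_finsetSum
    fun x _ => Continuous.intervalIntegrable (by fun_prop) _ _, Finset.mul_sum]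
  refine Finset.sum_congr rfl fun x hx => ?_
  rw [intervalIntegral.integral_finsetSum
    fun x _ => Continuous.intervalIntegrable (by fun_prop) _ _, Finset.sum_eq_single x]
  · have hn : inner ℂ (Ψ x) (Ψ x) = ((‖Ψ x‖ ^ 2 : ℝ) : ℂ) := by
      rw [inner_self_eq_norm_sq_to_K]
      norm_cast
    rw [intervalIntegral.integral_const_mul, integral_exp_int_mul_I, if_pos (sub_self x), hn,
      Complex.real_smul]
    ring
  · intro y _ hy
    rw [intervalIntegral.integral_const_mul, integral_exp_int_mul_I,
      if_neg (sub_ne_zero.2 hy.symm), mul_zero]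
  · exact fun h' => absurd hx h'

/-! ### The law of the position -/

theorem findingProb_eq (θ : ℝ) (α β : ℂ) (t : ℕ) (x : ℤ) :
    findingProb θ α β t x = ‖state θ α β t x‖ ^ 2 := by
  rw [findingProb, positionProj, lp.inner_single_right, inner_self_eq_norm_sq_to_K]
  norm_cast

theorem integral_law (θ : ℝ) (α β : ℂ) (t : ℕ) (f : ℤ → ℂ) :
    ∫ n, f n ∂(law θ α β t) = ∑' n : ℤ, (‖state θ α β t n‖ ^ 2 : ℝ) • f n := by
  rw [law, integral_sum_dirac fun _ => ENNReal.ofReal_ne_top]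
  refine tsum_congr fun n => ?_
  rw [findingProb_eq, ENNReal.toReal_ofReal (by positivity)]

/-- The matrix element `⟨φ, A φ⟩` with `φ = α|0⟩ + β|1⟩`. -/
def coinForm (α β : ℂ) (A : Matrix (Fin 2) (Fin 2) ℂ) : ℂ :=
  inner ℂ (!₂[α, β] : Coin) (Matrix.toEuclideanCLM (n := Fin 2) (𝕜 := ℂ) A !₂[α, β])

theorem coinForm_eq (α β : ℂ) (A : Matrix (Fin 2) (Fin 2) ℂ) :
    coinForm α β A = conj α * (A 0 0 * α + A 0 1 * β) + conj β * (A 1 0 * α + A 1 1 * β) := by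
  simp only [coinForm, Matrix.toEuclideanCLM_toLp, EuclideanSpace.inner_toLp_toLp, dotProduct,
    Matrix.mulVec, Fin.sum_univ_two, Pi.star_apply, Matrix.cons_val_zero, Matrix.cons_val_one,
    Matrix.cons_val_fin_one, RCLike.star_def]
  ring

theorem inner_fourier_state (θ : ℝ) (α β : ℂ) (t : ℕ) (k l : ℝ) :
    inner ℂ (fourier (state θ α β t) k) (fourier (state θ α β t) l) =
      coinForm α β (star (symbol θ k ^ t) * symbol θ l ^ t) := by
  rw [fourier_state, fourier_state, coinForm, map_mul, map_star,
    ContinuousLinearMap.star_eq_adjoint, mul_apply_eq_comp,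
    ContinuousLinearMap.adjoint_inner_right]

theorem integral_exp_law (θ : ℝ) (α β : ℂ) (t : ℕ) (η : ℝ) :
    ∫ n : ℤ, Complex.exp (η * n * Complex.I) ∂(law θ α β t) = (2 * Real.pi : ℂ)⁻¹ *
      ∫ k in (-Real.pi)..Real.pi, coinForm α β (star (symbol θ k ^ t) * symbol θ (k - η) ^ t) := by
  simp_rw [← inner_fourier_state]
  rw [integral_inner_fourier (finite_support_state θ α β t), integral_law, inv_mul_cancel_left₀]
  exact mul_ne_zero two_ne_zero (by exact_mod_cast Real.pi_ne_zero)

/-! ### Unitarity of the symbol and total mass of the law. -/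

theorem symbol₁_mul_self (θ k : ℝ) : symbol₁ θ k * symbol₁ θ k = 1 := by
  have h := Complex.cos_sq_add_sin_sq θ
  have h' := Complex.cos_sq_add_sin_sq k
  ext i j
  fin_cases i <;> fin_cases j <;> simp [symbol₁, Matrix.mul_apply, Fin.sum_univ_two] <;> ring_nf
  all_goals simp only [Complex.I_sq]
  all_goals linear_combination (Complex.cos θ) ^ 2 * h' + h

theorem symbol₂_mul_self (θ k : ℝ) : symbol₂ θ k * symbol₂ θ k = 1 := by
  have h := Complex.cos_sq_add_sin_sq θ
  have h' := Complex.cos_sq_add_sin_sq k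
  ext i j
  fin_cases i <;> fin_cases j <;> simp [symbol₂, Matrix.mul_apply, Fin.sum_univ_two] <;> ring_nf
  all_goals simp only [Complex.I_sq]
  all_goals linear_combination (Complex.sin θ) ^ 2 * h' + h

theorem star_symbol₁ (θ k : ℝ) : star (symbol₁ θ k) = symbol₁ θ k := by
  rw [Matrix.star_eq_conjTranspose]
  ext i j
  fin_cases i <;> fin_cases j <;>
    simp [symbol₁, -Complex.ofReal_cos, -Complex.ofReal_sin, Complex.conj_ofReal, sub_eq_add_neg]

theorem star_symbol₂ (θ k : ℝ) : star (symbol₂ θ k) = symbol₂ θ k := by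
  rw [Matrix.star_eq_conjTranspose]
  ext i j
  fin_cases i <;> fin_cases j <;>
    simp [symbol₂, -Complex.ofReal_cos, -Complex.ofReal_sin, Complex.conj_ofReal, sub_eq_add_neg]

theorem symbol_mem_unitaryGroup (θ k : ℝ) : symbol θ k ∈ Matrix.unitaryGroup (Fin 2) ℂ := by
  refine mul_mem ?_ ?_ <;> rw [Matrix.mem_unitaryGroup_iff]
  · rw [star_symbol₂, symbol₂_mul_self]
  · rw [star_symbol₁, symbol₁_mul_self]

theorem coinForm_one {α β : ℂ} (h : ‖α‖ ^ 2 + ‖β‖ ^ 2 = 1) : coinForm α β 1 = 1 := by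
  have h' : ((‖α‖ ^ 2 + ‖β‖ ^ 2 : ℝ) : ℂ) = 1 := by rw [h]; simp
  rw [coinForm_eq]
  push_cast at h'
  simp only [← Complex.conj_mul'] at h'
  simpa using h'

theorem isProbabilityMeasure_law (θ : ℝ) {α β : ℂ} (h : ‖α‖ ^ 2 + ‖β‖ ^ 2 = 1) (t : ℕ) :
    IsProbabilityMeasure (law θ α β t) := by
  -- At `η = 0` the characteristic function is the total mass, and unitarity makes the integrand
  -- constantly 1.
  have h1 := integral_exp_law θ α β t 0
  have h2 : ∀ k, star (symbol θ k ^ t) * symbol θ k ^ t = 1 := fun k =>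
    (Unitary.mem_iff.1 (pow_mem (symbol_mem_unitaryGroup θ k) t)).1
  simp only [Complex.ofReal_zero, zero_mul, Complex.exp_zero, sub_zero, h2, coinForm_one h,
    integral_const, intervalIntegral.integral_const, Complex.real_smul, mul_one] at h1
  have h3 : (law θ α β t).real Set.univ = 1 := by
    have : (Real.pi : ℂ) ≠ 0 := by exact_mod_cast Real.pi_ne_zero
    have : ((law θ α β t).real Set.univ : ℂ) = 1 := by
      rw [h1]; push_cast; field_simp; ring
    exact_mod_cast this
  exact ⟨(ENNReal.toReal_eq_one_iff _).1 h3⟩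

/-! ### The group velocity and the limit density -/

/-- The group velocity of the walk at momentum `k`. -/
def velocity (k : ℝ) : ℝ := 2 * Real.sin (k / 2) / √(1 + Real.sin (k / 2) ^ 2)

/-- The coefficient of the asymmetric part of the limit density. -/
def bias (α β : ℂ) : ℝ := ‖α‖ ^ 2 - ‖β‖ ^ 2 + (α * conj β + conj α * β).re

theorem one_add_sin_sq_pos (x : ℝ) : 0 < 1 + Real.sin x ^ 2 := by positivity

theorem cos_half_pos {k : ℝ} (hk : k ∈ Set.Ioo (-Real.pi) Real.pi) : 0 < Real.cos (k / 2) :=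
  Real.cos_pos_of_mem_Ioo ⟨by linarith [hk.1], by linarith [hk.2]⟩

theorem hasDerivAt_velocity (k : ℝ) :
    HasDerivAt velocity
      (Real.cos (k / 2) / ((1 + Real.sin (k / 2) ^ 2) * √(1 + Real.sin (k / 2) ^ 2))) k := by
  have hp := one_add_sin_sq_pos (k / 2)
  have hr : √(1 + Real.sin (k / 2) ^ 2) ≠ 0 := (Real.sqrt_pos.2 hp).ne'
  have hsq := Real.sq_sqrt hp.le
  have h1 : HasDerivAt (fun k : ℝ => Real.sin (k / 2)) (Real.cos (k / 2) * (1 / 2)) k :=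
    ((hasDerivAt_id k).div_const 2).sin
  have h2 := ((h1.pow 2).const_add 1).sqrt hp.ne'
  have h3 := (h1.const_mul 2).div h2 hr
  refine h3.congr_deriv ?_
  simp only [Pi.pow_apply]
  generalize √(1 + Real.sin (k / 2) ^ 2) = r at *
  rw [← hsq]
  field_simp
  push_cast
  linear_combination 2 * Real.cos (k / 2) * hsq

theorem velocity_strictMonoOn : StrictMonoOn velocity (Set.Ioo (-Real.pi) Real.pi) := by
  refine strictMonoOn_of_deriv_pos (convex_Ioo _ _)
    (fun k _ => (hasDerivAt_velocity k).continuousAt.continuousWithinAt) fun k hk => ?_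
  rw [interior_Ioo] at hk
  rw [(hasDerivAt_velocity k).deriv]
  have := cos_half_pos hk
  have := one_add_sin_sq_pos (k / 2)
  positivity

theorem continuous_velocity : Continuous velocity :=
  continuous_iff_continuousAt.2 fun k => (hasDerivAt_velocity k).continuousAt

theorem velocity_neg (k : ℝ) : velocity (-k) = -velocity k := by
  simp [velocity, neg_div]

theorem velocity_sq (k : ℝ) :
    velocity k ^ 2 = 4 * Real.sin (k / 2) ^ 2 / (1 + Real.sin (k / 2) ^ 2) := by
  rw [velocity, div_pow, Real.sq_sqrt (one_add_sin_sq_pos _).le]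
  ring

theorem velocity_image_Ioo : velocity '' Set.Ioo (-Real.pi) Real.pi = Set.Ioo (-√2) √2 := by
  ext y
  constructor
  · rintro ⟨k, hk, rfl⟩
    have hc := cos_half_pos hk
    have hp := one_add_sin_sq_pos (k / 2)
    refine abs_lt.1 (Real.lt_sqrt_of_sq_lt ?_)
    rw [sq_abs, velocity_sq, div_lt_iff₀ hp]
    nlinarith [Real.sin_sq_add_cos_sq (k / 2)]
  · intro hy
    have hy2 : y ^ 2 < 2 := Real.sq_lt.2 hy
    have h4 : 0 < 4 - y ^ 2 := by linarith
    have hr := Real.sqrt_pos.2 h4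
    have hrs := Real.sq_sqrt h4.le
    have hS : |y / √(4 - y ^ 2)| < 1 := by
      rw [← sq_lt_one_iff_abs_lt_one, div_pow, hrs, div_lt_one h4]
      linarith
    rw [abs_lt] at hS
    have ha := Real.arcsin_lt_pi_div_two.2 hS.2
    have hb := Real.neg_pi_div_two_lt_arcsin.2 hS.1
    -- Solving y = 2S/√(1 + S²) for S = sin(k/2) gives S = y/√(4 − y²).
    refine ⟨2 * Real.arcsin (y / √(4 - y ^ 2)), ⟨by linarith, by linarith⟩, ?_⟩
    have e : 1 + (y / √(4 - y ^ 2)) ^ 2 = (2 / √(4 - y ^ 2)) ^ 2 := by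
      rw [div_pow, div_pow, hrs]
      field_simp
      ring
    rw [velocity, mul_div_cancel_left₀ _ two_ne_zero, Real.sin_arcsin hS.1.le hS.2.le, e,
      Real.sqrt_sq (by positivity)]
    field_simp

/-- With S = sin(k/2) and C = cos(k/2), one has 4 − v² = 4/(1 + S²) and 2 − v² = 2C²/(1 + S²), so
the Jacobian cancels the singular factor of the density. In the variable `k` the symmetric part is
uniform on (−π, π). -/
theorem deriv_mul_limitDensity_velocity (α β : ℂ) {k : ℝ} (hk : k ∈ Set.Ioo (-Real.pi) Real.pi) :
    |Real.cos (k / 2) / ((1 + Real.sin (k / 2) ^ 2) * √(1 + Real.sin (k / 2) ^ 2))| *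
      limitDensity α β (velocity k) =
    (2 * Real.pi)⁻¹ * (1 - bias α β * (velocity k / 2)) := by
  have hc := cos_half_pos hk
  have hp := one_add_sin_sq_pos (k / 2)
  have hr := Real.sqrt_pos.2 hp
  have hrs := Real.sq_sqrt hp.le
  have hv : velocity k ∈ Set.Ioo (-√2) √2 := velocity_image_Ioo ▸ Set.mem_image_of_mem _ hk
  rw [abs_of_pos (by positivity), limitDensity, Set.indicator_of_mem hv, ← bias]
  have e1 : 4 - velocity k ^ 2 = 4 / (1 + Real.sin (k / 2) ^ 2) := by
    rw [velocity_sq]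
    field_simp
    ring
  have e2 : 2 - velocity k ^ 2 =
      2 * (Real.cos (k / 2) / √(1 + Real.sin (k / 2) ^ 2)) ^ 2 := by
    rw [velocity_sq, div_pow, hrs, Real.cos_sq']
    field_simp
    ring
  rw [e1, e2, Real.sqrt_mul (by norm_num), Real.sqrt_sq (by positivity), ← mul_assoc]
  congr 1
  have h2 : √(2 : ℝ) ≠ 0 := by positivity
  have := Real.pi_ne_zero
  field_simp
  ring

theorem limitDensity_eq_indicator (α β : ℂ) :
    limitDensity α β = (Set.Ioo (-√2) √2).indicator (limitDensity α β) := by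
  rw [limitDensity, Set.indicator_indicator, Set.inter_self]

theorem integrable_limitDensity (α β : ℂ) : Integrable (limitDensity α β) := by
  rw [limitDensity_eq_indicator, integrable_indicator_iff measurableSet_Ioo, ← velocity_image_Ioo,
    integrableOn_image_iff_integrableOn_abs_deriv_smul measurableSet_Ioo
      (fun k _ => (hasDerivAt_velocity k).hasDerivWithinAt) velocity_strictMonoOn.injOn]
  have hc : Continuous fun k => (2 * Real.pi)⁻¹ * (1 - bias α β * (velocity k / 2)) := by
    have := continuous_velocity
    fun_prop
  exact (hc.integrableOn_Icc.mono_set Set.Ioo_subset_Icc_self).congr_fun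
    (fun k hk => (deriv_mul_limitDensity_velocity α β hk).symm) measurableSet_Ioo

theorem integral_limitDensity_smul (α β : ℂ) (f : ℝ → ℂ) :
    ∫ y, limitDensity α β y • f y = (2 * Real.pi : ℂ)⁻¹ *
      ∫ k in (-Real.pi)..Real.pi, (1 - bias α β * (velocity k / 2) : ℝ) • f (velocity k) := by
  have h1 : (fun y => limitDensity α β y • f y) =
      (Set.Ioo (-√2) √2).indicator fun y => limitDensity α β y • f y := by
    conv_lhs => rw [limitDensity_eq_indicator]
    ext y
    rw [Set.indicator_smul_apply_left]
  rw [h1, integral_indicator measurableSet_Ioo, ← velocity_image_Ioo,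
    integral_image_eq_integral_abs_deriv_smul measurableSet_Ioo
      (fun k _ => (hasDerivAt_velocity k).hasDerivWithinAt) velocity_strictMonoOn.injOn,
    intervalIntegral.integral_of_le (by linarith [Real.pi_pos]), integral_Ioc_eq_integral_Ioo,
    ← integral_const_mul]
  refine setIntegral_congr_fun measurableSet_Ioo fun k hk => ?_
  rw [smul_smul, deriv_mul_limitDensity_velocity α β hk]
  simp only [Complex.real_smul]
  push_cast
  ring

theorem integral_eq_zero_of_odd {f : ℝ → ℂ} (hf : ∀ k, f (-k) = -f k) (a : ℝ) :
    ∫ k in (-a)..a, f k = 0 := by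
  have h := intervalIntegral.integral_comp_neg (a := -a) (b := a) f
  simp only [hf, intervalIntegral.integral_neg, neg_neg] at h
  exact self_eq_neg.1 h.symm

theorem integral_limitDensity (α β : ℂ) : ∫ y, limitDensity α β y = 1 := by
  have h := integral_limitDensity_smul α β fun _ => 1
  have hc := continuous_velocity
  have hsplit : (fun k => (1 - bias α β * (velocity k / 2) : ℝ) • (1 : ℂ)) =
      fun k => 1 - (bias α β * (velocity k / 2) : ℂ) := by
    ext k
    simp
  rw [hsplit, intervalIntegral.integral_sub (Continuous.intervalIntegrable (by fun_prop) _ _)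
    (Continuous.intervalIntegrable (by fun_prop) _ _),
    integral_eq_zero_of_odd (f := fun k => (bias α β * (velocity k / 2) : ℂ))
      (fun k => by rw [velocity_neg]; push_cast; ring)] at h
  simp only [Complex.real_smul, mul_one, intervalIntegral.integral_const, sub_zero] at h
  rw [integral_complex_ofReal] at h
  have hpi : (Real.pi : ℂ) ≠ 0 := by exact_mod_cast Real.pi_ne_zero
  have : ((∫ y, limitDensity α β y : ℝ) : ℂ) = 1 := by
    rw [h]
    push_cast
    field_simp
    ring
  exact_mod_cast this

theorem bias_sq_le {α β : ℂ} (h : ‖α‖ ^ 2 + ‖β‖ ^ 2 = 1) : bias α β ^ 2 ≤ 2 := by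
  simp only [bias, Complex.sq_norm, Complex.normSq_apply, Complex.add_re, Complex.mul_re,
    Complex.conj_re, Complex.conj_im] at h ⊢
  obtain ⟨a, b⟩ := α
  obtain ⟨c, d⟩ := β
  simp only at h ⊢
  -- The Bloch vector of a unit coin state has length 1. The bias is its inner product with (1, 1,
  -- 0), hence at most √2 in absolute value.
  have hid : (a * a + b * b - (c * c + d * d)) ^ 2 + (2 * (a * c + b * d)) ^ 2 +
      (2 * (a * d - b * c)) ^ 2 = 1 := by
    linear_combination (a * a + b * b + (c * c + d * d) + 1) * h
  nlinarith [sq_nonneg (a * a + b * b - (c * c + d * d) - 2 * (a * c + b * d)),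
    sq_nonneg (2 * (a * d - b * c))]

theorem limitDensity_pos {α β : ℂ} (h : ‖α‖ ^ 2 + ‖β‖ ^ 2 = 1) {y : ℝ}
    (hy : y ∈ Set.Ioo (-√2) √2) : 0 < limitDensity α β y := by
  have hy2 : y ^ 2 < 2 := Real.sq_lt.2 hy
  have hM := bias_sq_le h
  have h4 : 0 < 4 - y ^ 2 := by linarith
  have h2 : 0 < √(2 - y ^ 2) := Real.sqrt_pos.2 (by linarith)
  have hpi := Real.pi_pos
  rw [limitDensity, Set.indicator_of_mem hy, ← bias]
  refine mul_pos (by positivity) ?_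
  -- With M the bias, My ≤ (M² + y²)/2 < 2.
  nlinarith [sq_nonneg (bias α β - y)]

theorem limitDensity_nonneg {α β : ℂ} (h : ‖α‖ ^ 2 + ‖β‖ ^ 2 = 1) (y : ℝ) :
    0 ≤ limitDensity α β y := by
  by_cases hy : y ∈ Set.Ioo (-√2) √2
  · exact (limitDensity_pos h hy).le
  · rw [limitDensity, Set.indicator_of_notMem hy]

/-! ### Spectral decomposition of the symbol for `θ = π / 4` -/

/-- The dispersion relation: the eigenvalues of the symbol are `e^{± i phase(k)}`. -/
def phase (k : ℝ) : ℝ := 2 * Real.arcsin (Real.sin (k / 2) ^ 2)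

/-- The Hermitian involution that generates the symbol. -/
def axis (k : ℝ) : Matrix (Fin 2) (Fin 2) ℂ :=
  ((√(1 + Real.sin (k / 2) ^ 2))⁻¹ : ℂ) •
    !![(Real.sin (k / 2) : ℂ), Real.sin (k / 2) - Real.cos (k / 2) * Complex.I;
      Real.sin (k / 2) + Real.cos (k / 2) * Complex.I, -Real.sin (k / 2)]

theorem sqrt_one_sub_sin_pow_four {k : ℝ} (hk : k ∈ Set.Ioo (-Real.pi) Real.pi) :
    √(1 - (Real.sin (k / 2) ^ 2) ^ 2) = Real.cos (k / 2) * √(1 + Real.sin (k / 2) ^ 2) := by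
  have e : 1 - (Real.sin (k / 2) ^ 2) ^ 2 =
      Real.cos (k / 2) ^ 2 * (1 + Real.sin (k / 2) ^ 2) := by
    rw [Real.cos_sq']
    ring
  rw [e, Real.sqrt_mul (sq_nonneg _), Real.sqrt_sq (cos_half_pos hk).le]

theorem sin_arcsin_sin_sq (x : ℝ) : Real.sin (Real.arcsin (Real.sin x ^ 2)) = Real.sin x ^ 2 :=
  Real.sin_arcsin (by linarith [sq_nonneg (Real.sin x)]) (Real.sin_sq_le_one x)

theorem cos_phase (k : ℝ) : Real.cos (phase k) = 1 - 2 * Real.sin (k / 2) ^ 4 := by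
  rw [phase, Real.cos_two_mul, Real.cos_sq', sin_arcsin_sin_sq]
  ring

theorem sin_phase {k : ℝ} (hk : k ∈ Set.Ioo (-Real.pi) Real.pi) :
    Real.sin (phase k) =
      2 * Real.sin (k / 2) ^ 2 * Real.cos (k / 2) * √(1 + Real.sin (k / 2) ^ 2) := by
  rw [phase, Real.sin_two_mul, sin_arcsin_sin_sq, Real.cos_arcsin, sqrt_one_sub_sin_pow_four hk]
  ring

/-- The chain rule gives 2SC/√(1 − S⁴), with S and C the sine and cosine of k/2, and √(1 − S⁴) =
C√(1 + S²) since C > 0. At k = ±π the argument of arcsin reaches 1, whence the open interval. -/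
theorem hasDerivAt_phase {k : ℝ} (hk : k ∈ Set.Ioo (-Real.pi) Real.pi) :
    HasDerivAt phase (velocity k) k := by
  have hc := cos_half_pos hk
  have h1 : HasDerivAt (fun k : ℝ => Real.sin (k / 2)) (Real.cos (k / 2) * (1 / 2)) k :=
    ((hasDerivAt_id k).div_const 2).sin
  have hlt : Real.sin (k / 2) ^ 2 < 1 := by
    nlinarith [Real.sin_sq_add_cos_sq (k / 2)]
  have h2 := (((Real.hasDerivAt_arcsin (by linarith [sq_nonneg (Real.sin (k / 2))]) hlt.ne).comp k
    (h1.pow 2)).const_mul 2)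
  refine h2.congr_deriv ?_
  rw [sqrt_one_sub_sin_pow_four hk, velocity]
  have := Real.sqrt_pos.2 (one_add_sin_sq_pos (k / 2))
  field_simp
  push_cast
  ring

/-- A product of two traceless Hermitian involutions is a scalar plus i times a traceless Hermitian
matrix. Here sin ω absorbs the factor sin²(k/2) of the latter, so that `axis` has no singularity at
k = 0. -/
theorem symbol_pi_div_four {k : ℝ} (hk : k ∈ Set.Ioo (-Real.pi) Real.pi) :
    symbol (Real.pi / 4) k = (Real.cos (phase k) : ℂ) • (1 : Matrix (Fin 2) (Fin 2) ℂ) +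
      (Real.sin (phase k) * Complex.I : ℂ) • axis k := by
  have hr : (√(1 + Real.sin (k / 2) ^ 2) : ℂ) ≠ 0 := by
    exact_mod_cast (Real.sqrt_pos.2 (one_add_sin_sq_pos (k / 2))).ne'
  have hq : ((√2 / 2 : ℝ) : ℂ) ^ 2 = 1 / 2 := by
    norm_cast
    rw [div_pow, Real.sq_sqrt (by norm_num)]
    norm_num
  have hs : Real.sin k = 2 * Real.sin (k / 2) * Real.cos (k / 2) := by
    rw [← Real.sin_two_mul]
    ring_nf
  have hc : Real.cos k = 1 - 2 * Real.sin (k / 2) ^ 2 := by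
    rw [← Real.cos_two_mul_eq_one_sub]
    ring_nf
  have hcs : (Real.cos (k / 2) : ℂ) ^ 2 = 1 - (Real.sin (k / 2) : ℂ) ^ 2 := by
    rw [← Complex.ofReal_pow, Real.cos_sq']
    push_cast
    ring
  have hI := Complex.I_sq
  have e : (Real.sin (phase k) * Complex.I : ℂ) • axis k =
      (2 * (Real.sin (k / 2) : ℂ) ^ 2 * Real.cos (k / 2) * Complex.I) •
      !![(Real.sin (k / 2) : ℂ), Real.sin (k / 2) - Real.cos (k / 2) * Complex.I;
      Real.sin (k / 2) + Real.cos (k / 2) * Complex.I, -Real.sin (k / 2)] := by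
    rw [sin_phase hk, axis, smul_smul]
    congr 1
    push_cast at hr ⊢
    field_simp
  rw [e, cos_phase, symbol, symbol₁, symbol₂, Real.cos_pi_div_four, Real.sin_pi_div_four, hs, hc]
  -- What remains is polynomial algebra in q, S, C, i modulo q² = 1/2, C² = 1 − S², i² = −1.
  generalize ((√2 / 2 : ℝ) : ℂ) = q at *
  simp only [Complex.ofReal_sub, Complex.ofReal_mul, Complex.ofReal_pow, Complex.ofReal_one,
    Complex.ofReal_ofNat]
  generalize (Real.sin (k / 2) : ℂ) = S at *
  generalize (Real.cos (k / 2) : ℂ) = C at *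
  generalize Complex.I = i at *
  ext a b
  fin_cases a <;> fin_cases b <;> simp [Matrix.mul_apply, Fin.sum_univ_two]
  all_goals grind

theorem axis_mul_self (k : ℝ) : axis k * axis k = 1 := by
  have hp := one_add_sin_sq_pos (k / 2)
  have hr : (√(1 + Real.sin (k / 2) ^ 2) : ℂ) ≠ 0 := by
    exact_mod_cast (Real.sqrt_pos.2 hp).ne'
  have hrs : (√(1 + Real.sin (k / 2) ^ 2) : ℂ) ^ 2 = 1 + (Real.sin (k / 2) : ℂ) ^ 2 := by
    exact_mod_cast Real.sq_sqrt hp.le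
  have hcs : (Real.cos (k / 2) : ℂ) ^ 2 = 1 - (Real.sin (k / 2) : ℂ) ^ 2 := by
    rw [← Complex.ofReal_pow, Real.cos_sq']
    push_cast
    ring
  have hI := Complex.I_sq
  rw [axis, Matrix.smul_mul, Matrix.mul_smul, smul_smul]
  generalize (√(1 + Real.sin (k / 2) ^ 2) : ℂ) = r at *
  generalize (Real.sin (k / 2) : ℂ) = S at *
  generalize (Real.cos (k / 2) : ℂ) = C at *
  generalize Complex.I = i at *
  ext a b
  fin_cases a <;> fin_cases b <;> simp <;> field_simp <;> grind

theorem star_axis (k : ℝ) : star (axis k) = axis k := by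
  rw [Matrix.star_eq_conjTranspose]
  ext i j
  fin_cases i <;> fin_cases j <;>
    simp [axis, -Complex.ofReal_cos, -Complex.ofReal_sin, Complex.conj_ofReal, sub_eq_add_neg]

theorem continuous_axis : Continuous axis := by
  unfold axis
  have : ∀ k : ℝ, (√(1 + Real.sin (k / 2) ^ 2) : ℂ) ≠ 0 := fun k => by
    exact_mod_cast (Real.sqrt_pos.2 (one_add_sin_sq_pos (k / 2))).ne'
  refine Continuous.smul (Continuous.inv₀ (by fun_prop) this) (continuous_matrix fun i j => ?_)
  fin_cases i <;> fin_cases j <;> simp <;> fun_prop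

/-- De Moivre's formula: iN squares to −1 and plays the role of i. -/
theorem pow_cos_add_sin_smul {N : Matrix (Fin 2) (Fin 2) ℂ} (hN : N * N = 1) (ω : ℝ) (t : ℕ) :
    ((Real.cos ω : ℂ) • (1 : Matrix (Fin 2) (Fin 2) ℂ) + (Real.sin ω * Complex.I : ℂ) • N) ^ t =
      (Real.cos (t * ω) : ℂ) • (1 : Matrix (Fin 2) (Fin 2) ℂ) +
        (Real.sin (t * ω) * Complex.I : ℂ) • N := by
  induction t with
  | zero => simp
  | succ t ih =>
    have e : ((t + 1 : ℕ) : ℝ) * ω = t * ω + ω := by push_cast; ring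
    rw [pow_succ, ih, e, Real.cos_add, Real.sin_add]
    simp only [mul_add, add_mul, smul_mul_smul_comm, hN, one_mul, mul_one]
    have hI := Complex.I_mul_I
    push_cast
    match_scalars
    · linear_combination (Complex.sin (t * ω) * Complex.sin ω) * hI
    · ring

/-- Splitting of the overlap of two evolutions into its stationary-phase part and two errors. -/
theorem star_pow_mul_pow_symbol {k l : ℝ} (hk : k ∈ Set.Ioo (-Real.pi) Real.pi)
    (hl : l ∈ Set.Ioo (-Real.pi) Real.pi) (t : ℕ) :
    star (symbol (Real.pi / 4) k ^ t) * symbol (Real.pi / 4) l ^ t =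
      (Real.cos (t * (phase l - phase k)) : ℂ) • (1 : Matrix (Fin 2) (Fin 2) ℂ) +
      (Real.sin (t * (phase l - phase k)) * Complex.I : ℂ) • axis k +
      (Real.cos (t * phase k) * Real.sin (t * phase l) * Complex.I : ℂ) • (axis l - axis k) +
      (Real.sin (t * phase k) * Real.sin (t * phase l) : ℂ) • (axis k * axis l - 1) := by
  rw [symbol_pi_div_four hk, symbol_pi_div_four hl, pow_cos_add_sin_smul (axis_mul_self k),
    pow_cos_add_sin_smul (axis_mul_self l), star_add, star_smul, star_smul, star_one, star_axis,
    mul_sub, Real.cos_sub, Real.sin_sub]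
  simp only [mul_add, add_mul, smul_mul_smul_comm, one_mul, mul_one, star_mul', RCLike.star_def,
    Complex.conj_ofReal, Complex.conj_I]
  have hI := Complex.I_mul_I
  push_cast
  match_scalars
  · ring
  · ring
  · ring
  · linear_combination (-(Complex.sin (t * phase k) * Complex.sin (t * phase l))) * hI

theorem coinForm_add (α β : ℂ) (A B : Matrix (Fin 2) (Fin 2) ℂ) :
    coinForm α β (A + B) = coinForm α β A + coinForm α β B := by
  simp only [coinForm_eq, Matrix.add_apply]
  ring

theorem coinForm_smul (α β z : ℂ) (A : Matrix (Fin 2) (Fin 2) ℂ) :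
    coinForm α β (z • A) = z * coinForm α β A := by
  simp only [coinForm_eq, Matrix.smul_apply, smul_eq_mul]
  ring

theorem continuous_coinForm (α β : ℂ) : Continuous (coinForm α β) := by
  simp only [funext (coinForm_eq α β)]
  fun_prop

/-- A bound uniform in the unitary matrix, hence in `t` and `k`: it is the dominating constant for
the passage to the limit. -/
theorem norm_coinForm_le (α β : ℂ) {A : Matrix (Fin 2) (Fin 2) ℂ}
    (hA : A ∈ Matrix.unitaryGroup (Fin 2) ℂ) : ‖coinForm α β A‖ ≤ (‖α‖ + ‖β‖) ^ 2 := by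
  have h := entry_norm_bound_of_unitary hA
  have hrow : ∀ i, ‖A i 0 * α + A i 1 * β‖ ≤ ‖α‖ + ‖β‖ := fun i => by
    refine (norm_add_le _ _).trans ?_
    rw [norm_mul, norm_mul]
    exact add_le_add (mul_le_of_le_one_left (norm_nonneg _) (h i 0))
      (mul_le_of_le_one_left (norm_nonneg _) (h i 1))
  rw [coinForm_eq, sq, add_mul]
  refine (norm_add_le _ _).trans ?_
  rw [norm_mul, norm_mul, RCLike.norm_conj, RCLike.norm_conj]
  exact add_le_add (mul_le_mul_of_nonneg_left (hrow 0) (norm_nonneg _))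
    (mul_le_mul_of_nonneg_left (hrow 1) (norm_nonneg _))

theorem continuous_symbol (θ : ℝ) : Continuous (symbol θ) := by
  unfold symbol symbol₁ symbol₂
  refine Continuous.mul (continuous_matrix fun i j => ?_) (continuous_matrix fun i j => ?_) <;>
  fin_cases i <;> fin_cases j <;> simp <;> fun_prop

/-! ### Pointwise limit of the overlaps. -/

theorem tendsto_sub_div_natCast (k ξ : ℝ) :
    Tendsto (fun t : ℕ => k - ξ / t) atTop (𝓝 k) := by
  simpa using tendsto_const_nhds.sub (tendsto_const_div_atTop_nhds_zero_nat ξ)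

theorem tendsto_mul_phase_sub {k : ℝ} (hk : k ∈ Set.Ioo (-Real.pi) Real.pi) (ξ : ℝ) :
    Tendsto (fun t : ℕ => t * (phase (k - ξ / t) - phase k)) atTop (𝓝 (-(ξ * velocity k))) := by
  have h := (hasDerivAt_phase hk).hasFDerivAt.lim (-ξ) (c := fun t : ℕ => (t : ℝ)) (l := atTop)
    (by simpa using tendsto_natCast_atTop_atTop (R := ℝ))
  simp only [smul_eq_mul, ContinuousLinearMap.toSpanSingleton_apply] at h
  convert h using 2
  · ring_nf
  · ring_nf

theorem tendsto_mul_zero_of_norm_le {u v : ℕ → ℂ} (hu : ∀ t, ‖u t‖ ≤ 1)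
    (hv : Tendsto v atTop (𝓝 0)) : Tendsto (fun t => u t * v t) atTop (𝓝 0) :=
  squeeze_zero_norm (fun t => by
    rw [norm_mul]
    exact mul_le_of_le_one_left (norm_nonneg _) (hu t)) (tendsto_zero_iff_norm_tendsto_zero.1 hv)

theorem norm_ofReal_cos_le (x : ℝ) : ‖(Real.cos x : ℂ)‖ ≤ 1 := by
  rw [Complex.norm_real]
  exact Real.abs_cos_le_one x

theorem norm_ofReal_sin_le (x : ℝ) : ‖(Real.sin x : ℂ)‖ ≤ 1 := by
  rw [Complex.norm_real]
  exact Real.abs_sin_le_one x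

/-- Only the phase difference, magnified by `t`, survives. The other two terms have rapidly
oscillating but bounded coefficients, multiplied by matrices that vanish as k − ξ/t → k. -/
theorem tendsto_coinForm_symbol {α β : ℂ} (h : ‖α‖ ^ 2 + ‖β‖ ^ 2 = 1) (ξ : ℝ) {k : ℝ}
    (hk : k ∈ Set.Ioo (-Real.pi) Real.pi) :
    Tendsto (fun t : ℕ => coinForm α β
        (star (symbol (Real.pi / 4) k ^ t) * symbol (Real.pi / 4) (k - ξ / t) ^ t)) atTop
      (𝓝 (Real.cos (ξ * velocity k) -
        Real.sin (ξ * velocity k) * Complex.I * coinForm α β (axis k))) := by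
  have hl := tendsto_sub_div_natCast k ξ
  have hmem : ∀ᶠ t : ℕ in atTop, k - ξ / t ∈ Set.Ioo (-Real.pi) Real.pi :=
    hl.eventually (isOpen_Ioo.mem_nhds hk)
  have hω := tendsto_mul_phase_sub hk ξ
  have hN : Tendsto (fun t : ℕ => axis (k - ξ / t)) atTop (𝓝 (axis k)) :=
    (continuous_axis.tendsto k).comp hl
  have h3 : Tendsto (fun t : ℕ => coinForm α β (axis (k - ξ / t) - axis k)) atTop (𝓝 0) := by
    have := ((continuous_coinForm α β).tendsto _).comp (hN.sub_const (axis k))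
    rwa [sub_self, show coinForm α β 0 = 0 by simp [coinForm_eq]] at this
  have h4 : Tendsto (fun t : ℕ => coinForm α β (axis k * axis (k - ξ / t) - 1)) atTop (𝓝 0) := by
    have := ((continuous_coinForm α β).tendsto _).comp
      ((hN.const_mul (axis k)).sub_const 1)
    rwa [axis_mul_self, sub_self, show coinForm α β 0 = 0 by simp [coinForm_eq]] at this
  have h1 : Tendsto (fun t : ℕ => (Real.cos (t * (phase (k - ξ / t) - phase k)) : ℂ)) atTop
      (𝓝 (Real.cos (ξ * velocity k))) := by
    rw [← Real.cos_neg]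
    exact ((Complex.continuous_ofReal.comp Real.continuous_cos).tendsto _).comp hω
  have h2 : Tendsto (fun t : ℕ => (Real.sin (t * (phase (k - ξ / t) - phase k)) : ℂ)) atTop
      (𝓝 (-Real.sin (ξ * velocity k) : ℝ)) := by
    rw [← Real.sin_neg]
    exact ((Complex.continuous_ofReal.comp Real.continuous_sin).tendsto _).comp hω
  have h5 := tendsto_mul_zero_of_norm_le (u := fun t : ℕ => (Real.cos (t * phase k) *
    Real.sin (t * phase (k - ξ / t)) * Complex.I : ℂ)) (fun t => by
      rw [norm_mul, norm_mul, Complex.norm_I, mul_one]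
      exact mul_le_one₀ (norm_ofReal_cos_le _) (norm_nonneg _) (norm_ofReal_sin_le _)) h3
  have h6 := tendsto_mul_zero_of_norm_le (u := fun t : ℕ => (Real.sin (t * phase k) *
    Real.sin (t * phase (k - ξ / t)) : ℂ)) (fun t => by
      rw [norm_mul]
      exact mul_le_one₀ (norm_ofReal_sin_le _) (norm_nonneg _) (norm_ofReal_sin_le _)) h4
  have key := ((h1.add ((h2.mul_const Complex.I).mul_const (coinForm α β (axis k)))).add h5).add h6
  have e : (Real.cos (ξ * velocity k) : ℂ) -
      Real.sin (ξ * velocity k) * Complex.I * coinForm α β (axis k) =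
      Real.cos (ξ * velocity k) + (-Real.sin (ξ * velocity k) : ℝ) * Complex.I *
        coinForm α β (axis k) + 0 + 0 := by
    push_cast
    ring
  rw [e]
  refine key.congr' (hmem.mono fun t ht => ?_)
  beta_reduce
  rw [star_pow_mul_pow_symbol hk ht, coinForm_add, coinForm_add, coinForm_add, coinForm_smul,
    coinForm_smul, coinForm_smul, coinForm_smul, coinForm_one h, mul_one]

/-! ### Convergence of the characteristic functions -/

/-- This splits the form by parity in `k`: the bias term is odd, the other term is even. -/
theorem coinForm_axis (α β : ℂ) (k : ℝ) :
    coinForm α β (axis k) = bias α β * (velocity k / 2) +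
      (Real.cos (k / 2) / √(1 + Real.sin (k / 2) ^ 2) : ℝ) *
        ((α * conj β - conj α * β) * Complex.I) := by
  have hr : (√(1 + Real.sin (k / 2) ^ 2) : ℂ) ≠ 0 := by
    exact_mod_cast (Real.sqrt_pos.2 (one_add_sin_sq_pos (k / 2))).ne'
  have hM : (bias α β : ℂ) = conj α * α - conj β * β + (α * conj β + conj α * β) := by
    have h1 : ((α * conj β + conj α * β).re : ℂ) = α * conj β + conj α * β := by
      rw [← Complex.conj_eq_iff_re]
      simp
      ring
    rw [bias, Complex.ofReal_add, h1]
    push_cast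
    rw [Complex.conj_mul', Complex.conj_mul']
  rw [coinForm_eq, hM, velocity, axis]
  simp only [Complex.ofReal_div, Complex.ofReal_mul, Complex.ofReal_ofNat]
  generalize (√(1 + Real.sin (k / 2) ^ 2) : ℂ) = r at *
  simp [-Complex.ofReal_cos, -Complex.ofReal_sin]
  field_simp
  ring

theorem integral_stationary_phase (α β : ℂ) (ξ : ℝ) :
    ∫ k in (-Real.pi)..Real.pi, ((Real.cos (ξ * velocity k) : ℂ) -
        Real.sin (ξ * velocity k) * Complex.I * coinForm α β (axis k)) =
      ∫ k in (-Real.pi)..Real.pi,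
        (1 - bias α β * (velocity k / 2) : ℝ) • Complex.exp (ξ * velocity k * Complex.I) := by
  have hv := continuous_velocity
  have ha := (continuous_coinForm α β).comp continuous_axis
  simp only [Function.comp_def] at ha
  rw [← sub_eq_zero, ← intervalIntegral.integral_sub
    (Continuous.intervalIntegrable (by fun_prop) _ _)
    (Continuous.intervalIntegrable (by fun_prop) _ _)]
  -- The difference of the integrands is combined from v cos(ξv), sin(ξv) and sin(ξv) times an even
  -- function, all odd because v is odd.
  refine integral_eq_zero_of_odd (fun k => ?_) _
  have he : ∀ k, Complex.exp (ξ * velocity k * Complex.I) =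
      Real.cos (ξ * velocity k) + Real.sin (ξ * velocity k) * Complex.I := fun k => by
    rw [← exp_mul_I]
    push_cast
    rfl
  rw [he, he, coinForm_axis, coinForm_axis, velocity_neg, mul_neg, Real.cos_neg, Real.sin_neg,
    neg_div, Real.cos_neg, Real.sin_neg, neg_sq]
  simp only [Complex.real_smul]
  push_cast
  ring

/-- Passing from π/4 to 3π/4 flips cos θ, and the shift by π flips cos k and sin k. The global sign
cancels in the overlaps, which contain S^{*t} and S^t equally often. -/
theorem symbol_add_pi (k : ℝ) :
    symbol (3 * Real.pi / 4) (k + Real.pi) = -symbol (Real.pi / 4) k := by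
  have hθ : 3 * Real.pi / 4 = Real.pi - Real.pi / 4 := by ring
  have h1 : symbol₁ (3 * Real.pi / 4) (k + Real.pi) = symbol₁ (Real.pi / 4) k := by
    rw [hθ, symbol₁, symbol₁, Real.cos_pi_sub, Real.sin_pi_sub, Real.cos_add_pi, Real.sin_add_pi]
    ext i j
    fin_cases i <;> fin_cases j <;> simp
  have h2 : symbol₂ (3 * Real.pi / 4) (k + Real.pi) = -symbol₂ (Real.pi / 4) k := by
    rw [hθ, symbol₂, symbol₂, Real.cos_pi_sub, Real.sin_pi_sub, Real.cos_add_pi, Real.sin_add_pi]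
    ext i j
    fin_cases i <;> fin_cases j <;> simp <;> ring
  rw [symbol, h1, h2, symbol, neg_mul]

theorem symbol_periodic (θ : ℝ) : Function.Periodic (symbol θ) (2 * Real.pi) := fun k => by
  simp only [symbol, symbol₁, symbol₂, Real.cos_add_two_pi, Real.sin_add_two_pi]

theorem integral_coinForm_symbol_three_pi_div_four (α β : ℂ) (t : ℕ) (η : ℝ) :
    ∫ k in (-Real.pi)..Real.pi, coinForm α β
        (star (symbol (3 * Real.pi / 4) k ^ t) * symbol (3 * Real.pi / 4) (k - η) ^ t) =
      ∫ k in (-Real.pi)..Real.pi, coinForm α β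
        (star (symbol (Real.pi / 4) k ^ t) * symbol (Real.pi / 4) (k - η) ^ t) := by
  set f : ℝ → ℂ := fun k => coinForm α β
    (star (symbol (3 * Real.pi / 4) k ^ t) * symbol (3 * Real.pi / 4) (k - η) ^ t) with hf
  have hper : Function.Periodic f (2 * Real.pi) := fun k => by
    simp only [hf]
    rw [symbol_periodic, add_sub_right_comm, symbol_periodic]
  have hshift : ∀ k, coinForm α β
      (star (symbol (Real.pi / 4) k ^ t) * symbol (Real.pi / 4) (k - η) ^ t) =
      f (k + Real.pi) := fun k => by
    simp only [hf]
    rw [add_sub_right_comm, symbol_add_pi, symbol_add_pi, neg_pow, neg_pow (symbol _ _), star_mul,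
      star_pow (-1 : Matrix (Fin 2) (Fin 2) ℂ), star_neg, star_one, mul_assoc,
      ← mul_assoc ((-1) ^ t), ← (Commute.refl _).mul_pow, neg_one_mul, neg_neg, one_pow, one_mul]
  simp_rw [hshift]
  rw [intervalIntegral.integral_comp_add_right]
  have := hper.intervalIntegral_add_eq (-Real.pi) 0
  rw [show -Real.pi + 2 * Real.pi = Real.pi by ring] at this
  rw [this]
  congr 1 <;> ring

theorem tendsto_integral_exp_law {θ : ℝ} (hθ : θ = Real.pi / 4 ∨ θ = 3 * Real.pi / 4) {α β : ℂ}
    (h : ‖α‖ ^ 2 + ‖β‖ ^ 2 = 1) (ξ : ℝ) :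
    Tendsto (fun t : ℕ => ∫ n : ℤ, Complex.exp ((ξ / t : ℝ) * n * Complex.I) ∂(law θ α β t)) atTop
      (𝓝 (∫ y, limitDensity α β y • Complex.exp (ξ * y * Complex.I))) := by
  have hred : ∀ t : ℕ, ∫ n : ℤ, Complex.exp ((ξ / t : ℝ) * n * Complex.I) ∂(law θ α β t) =
      (2 * Real.pi : ℂ)⁻¹ * ∫ k in (-Real.pi)..Real.pi, coinForm α β
        (star (symbol (Real.pi / 4) k ^ t) * symbol (Real.pi / 4) (k - ξ / t) ^ t) := fun t => by
    rw [integral_exp_law]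
    rcases hθ with rfl | rfl
    · rfl
    · rw [integral_coinForm_symbol_three_pi_div_four]
  simp_rw [hred]
  rw [integral_limitDensity_smul, ← integral_stationary_phase]
  refine Tendsto.const_mul _ ?_
  refine intervalIntegral.tendsto_integral_filter_of_dominated_convergence
    (fun _ => (‖α‖ + ‖β‖) ^ 2) (Eventually.of_forall fun t => ?_)
    (Eventually.of_forall fun t => Eventually.of_forall fun k _ => ?_) (by simp) ?_
  · have hs := continuous_symbol (Real.pi / 4)
    refine Continuous.aestronglyMeasurable ((continuous_coinForm α β).comp ?_)
    exact ((hs.pow t).star).mul ((hs.comp (continuous_id.sub continuous_const)).pow t)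
  · exact norm_coinForm_le α β (mul_mem (Unitary.star_mem (pow_mem (symbol_mem_unitaryGroup _ _) t))
      (pow_mem (symbol_mem_unitaryGroup _ _) t))
  · have hne : ∀ᵐ k : ℝ, k ≠ Real.pi := by simp [ae_iff]
    filter_upwards [hne] with k hk hmem
    rw [Set.uIoc_of_le (by linarith [Real.pi_pos])] at hmem
    exact tendsto_coinForm_symbol h ξ ⟨hmem.1, lt_of_le_of_ne hmem.2 hk⟩

/-! ### Weak convergence of the rescaled position -/

/-- The limit distribution. -/
def limitLaw (α β : ℂ) : Measure ℝ :=
  volume.withDensity fun y => ENNReal.ofReal (limitDensity α β y)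

theorem limitLaw_apply {α β : ℂ} (h : ‖α‖ ^ 2 + ‖β‖ ^ 2 = 1) {s : Set ℝ} (hs : MeasurableSet s) :
    limitLaw α β s = ENNReal.ofReal (∫ y in s, limitDensity α β y) := by
  rw [limitLaw, withDensity_apply _ hs, ofReal_integral_eq_lintegral_ofReal
    (integrable_limitDensity α β).integrableOn
    (Eventually.of_forall fun y => limitDensity_nonneg h y)]

theorem isProbabilityMeasure_limitLaw {α β : ℂ} (h : ‖α‖ ^ 2 + ‖β‖ ^ 2 = 1) :
    IsProbabilityMeasure (limitLaw α β) :=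
  ⟨by rw [limitLaw_apply h MeasurableSet.univ, setIntegral_univ, integral_limitDensity,
    ENNReal.ofReal_one]⟩

theorem charFun_limitLaw {α β : ℂ} (h : ‖α‖ ^ 2 + ‖β‖ ^ 2 = 1) (ξ : ℝ) :
    charFun (limitLaw α β) ξ = ∫ y, limitDensity α β y • Complex.exp (ξ * y * Complex.I) := by
  rw [charFun_apply_real, limitLaw, integral_withDensity_eq_integral_toReal_smul₀
    (integrable_limitDensity α β).aestronglyMeasurable.aemeasurable.ennreal_ofReal
    (Eventually.of_forall fun _ => ENNReal.ofReal_lt_top)]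
  simp only [ENNReal.toReal_ofReal (limitDensity_nonneg h _)]

/-- The distribution of `X_t / t`. -/
def scaledLaw (θ : ℝ) (α β : ℂ) (t : ℕ) : Measure ℝ :=
  (law θ α β t).map fun n : ℤ => (n : ℝ) / t

/-- This includes `t = 0`, where both quotients take the default value 0. -/
theorem charFun_scaledLaw (θ : ℝ) (α β : ℂ) (t : ℕ) (ξ : ℝ) :
    charFun (scaledLaw θ α β t) ξ =
      ∫ n : ℤ, Complex.exp ((ξ / t : ℝ) * n * Complex.I) ∂(law θ α β t) := by
  rw [charFun_apply_real, scaledLaw, integral_map (measurable_of_countable _).aemeasurable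
    (Continuous.aestronglyMeasurable (by fun_prop))]
  refine integral_congr_ae (Eventually.of_forall fun n => ?_)
  beta_reduce
  congr 1
  push_cast
  ring

theorem tendsto_law_le {θ : ℝ} (hθ : θ = Real.pi / 4 ∨ θ = 3 * Real.pi / 4) {α β : ℂ}
    (h : ‖α‖ ^ 2 + ‖β‖ ^ 2 = 1) (x : ℝ) :
    Tendsto (fun t : ℕ => (law θ α β t).real {n : ℤ | (n : ℝ) / (t : ℝ) ≤ x}) atTop
      (𝓝 (∫ y in Set.Iic x, limitDensity α β y)) := by
  have hlaw := isProbabilityMeasure_law θ h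
  have hlim := isProbabilityMeasure_limitLaw h
  have hsc : ∀ t, IsProbabilityMeasure (scaledLaw θ α β t) := fun t =>
    Measure.isProbabilityMeasure_map (measurable_of_countable _).aemeasurable
  let μs : ℕ → ProbabilityMeasure ℝ := fun t => ⟨scaledLaw θ α β t, hsc t⟩
  let μ : ProbabilityMeasure ℝ := ⟨limitLaw α β, hlim⟩
  have hw : Tendsto μs atTop (𝓝 μ) := by
    refine ProbabilityMeasure.tendsto_of_tendsto_charFun fun ξ => ?_
    simp only [μs, μ, ProbabilityMeasure.coe_mk, charFun_scaledLaw, charFun_limitLaw h]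
    exact tendsto_integral_exp_law hθ h ξ
  -- The limit law has no atoms, so every half-line is a continuity set and weak convergence gives
  -- convergence of distribution functions everywhere.
  have hfr : limitLaw α β (frontier (Set.Iic x)) = 0 := by
    rw [frontier_Iic]
    exact withDensity_absolutelyContinuous _ _ Real.volume_singleton
  have key := ProbabilityMeasure.tendsto_measure_of_null_frontier_of_tendsto' hw
    (E := Set.Iic x) hfr
  simp only [μs, μ, ProbabilityMeasure.coe_mk] at key
  have key' := (ENNReal.tendsto_toReal (measure_ne_top (limitLaw α β) (Set.Iic x))).comp key
  rw [limitLaw_apply h measurableSet_Iic, ENNReal.toReal_ofReal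
    (integral_nonneg fun y => limitDensity_nonneg h y)] at key'
  refine key'.congr fun t => ?_
  simp only [Function.comp_apply, scaledLaw]
  rw [Measure.map_apply (measurable_of_countable _) measurableSet_Iic]
  rfl

end QWalk

end

theorem theorem1 (θ : ℝ) (hθ : θ = Real.pi / 4 ∨ θ = 3 * Real.pi / 4)
    (α β : ℂ) (hαβ : ‖α‖ ^ 2 + ‖β‖ ^ 2 = 1) :
    (∀ t : ℕ, IsProbabilityMeasure (QWalk.law θ α β t)) ∧
    (∀ y ∈ Set.Ioo (-√2) √2, 0 < QWalk.limitDensity α β y) ∧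
    Integrable (QWalk.limitDensity α β) ∧
    ∫ y, QWalk.limitDensity α β y = 1 ∧
    ∀ x : ℝ, Tendsto
      (fun t : ℕ => (QWalk.law θ α β t).real {n : ℤ | (n : ℝ) / (t : ℝ) ≤ x}) atTop
      (𝓝 (∫ y in Set.Iic x, QWalk.limitDensity α β y)) :=
  ⟨QWalk.isProbabilityMeasure_law θ hαβ, fun _ hy => QWalk.limitDensity_pos hαβ hy,
    QWalk.integrable_limitDensity α β, QWalk.integral_limitDensity α β,
    QWalk.tendsto_law_le hθ hαβ⟩
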